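/- Let $n,m,p$ be natural numbers, and let $\mathcal I$ be the set of compact intervals $Q=[\underline q,\overline q]$, $\underline q\le\overline q$, of real numbers, with $Q+R=[\underline q+\underline r,\overline q+\overline r]$, center $q^c=(\underline q+\overline q)/2$, width $q^w=(\overline q-\underline q)/2$, and write $Q\prec_{CW}R$ if $q^c<r^c$ and $q^w<r^w$. Equip $\mathbb R^n$ with the Euclidean norm and let $\mathbb B^n$ be its closed unit ball. Let $F_k:\mathbb R^n\to\mathcal I$, $F_k=[\underline F_k,\overline F_k]$ ($k\in K=\{1,\dots,m\}$), be locally Lipschitz, that is, every $u_0\in\mathbb R^n$ has a neighbourhood $U$ and a constant $L>0$ with $\max\{|\underline F_k(u_1)-\underline F_k(u_2)|,|\overline F_k(u_1)-\overline F_k(u_2)|\}\le L\|u_1-u_2\|$ for all $u_1,u_2\in U$; let $g_j:\mathbb R^n\to\mathbb R$ ($j\in J=\{1,\dots,p\}$) be locally Lipschitz; and put $S=\{u\in\mathbb R^n: g_j(u)\le 0\ \forall j\in J\}$ and $I(u)=\{j\in J:g_j(u)=0\}$. For a locally Lipschitz $\psi:\mathbb R^n\to\mathbb R$ let $\psi^0(z;w)=\limsup_{u\to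 z,\,t\to0^+}\frac{\psi(u+tw)-\psi(u)}{t}$ and let $\partial^0\psi(z)=\{z^*\in\mathbb R^n:\langle z^*,w\rangle\le\psi^0(z;w)\ \forall w\in\mathbb R^n\}$ be the Clarke generalized gradient; let $\partial^0F_k(u)=\mathrm{co}\big(\partial^0F_k^c(u)\cup\partial^0F_k^w(u)\big)$, where $F_k^c=(\underline F_k+\overline F_k)/2$ and $F_k^w=(\overline F_k-\underline F_k)/2$. Sums and multiples of sets are Minkowski sums and dilations. Let $\varepsilon=(\varepsilon_1,\dots,\varepsilon_m)\in\mathbb R^m_+\setminus\{0\}$, and let $\overline u\in S$ be a weak $\varepsilon$-quasi-minimal solution of minimizing $F=(F_1,\dots,F_m)$ over $S$: there is no $z\in S$ with $F_k(z)+[0,\varepsilon_k\|z-\overline u\|]\prec_{CW}F_k(\overline u)$ for all $k\in K$. Assume the basic constraint qualification (BCQ) at $\overline u$: there is no $\mu\in\mathbb R^p_+\setminus\{0\}$ with $\mu_j=0$ for all $j\notin I(\overline u)$ and $0\in\sum_{j\in J}\mu_j\,\partial^0g_j(\overline u)$. Then there exist $\lambda\in\mathbb R^m_+$ with $\sum_{k\in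 K}\lambda_k=1$ and $\mu\in\mathbb R^p_+$ such that $$0\in\sum_{k\in K}\lambda_k\,\partial^0F_k(\overline u)+\sum_{j\in I(\overline u)}\mu_j\,\partial^0g_j(\overline u)+\sum_{k\in K}\lambda_k\varepsilon_k\,\mathbb B^n,\qquad \mu_jg_j(\overline u)=0\quad\forall j\in J.$$ -/

import Mathlib

open scoped NNReal Topology Pointwise

noncomputable section

namespace MIOP

/-! ### Compact real intervals

The set of all closed bounded real intervals `[a, b]` with `a ≤ b` is `NonemptyInterval ℝ`;
Mathlib's addition on it is endpointwise, and `Q - P = [q₁ - p₂, q₂ - p₁] = Q + (-1) P`. -/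

/-- The center `(a + b) / 2` of the interval `[a, b]`. -/
def center (Q : NonemptyInterval ℝ) : ℝ := (Q.fst + Q.snd) / 2

/-- The (half-)width `(b - a) / 2` of the interval `[a, b]`. -/
def width (Q : NonemptyInterval ℝ) : ℝ := (Q.snd - Q.fst) / 2

/-- The strict center-width order: both center and width are strictly smaller. -/
def CWLt (Q R : NonemptyInterval ℝ) : Prop :=
  center Q < center R ∧ width Q < width R

/-- The interval norm `max {|a|, |b|}` of `[a, b]`. -/
def ivNorm (Q : NonemptyInterval ℝ) : ℝ := max |Q.fst| |Q.snd|

/-- The generalized Hukuhara difference of two intervals, in closed form. -/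
def gHSub (Q R : NonemptyInterval ℝ) : NonemptyInterval ℝ :=
  ⟨(min (Q.fst - R.fst) (Q.snd - R.snd), max (Q.fst - R.fst) (Q.snd - R.snd)), min_le_max⟩

/-- The defining property of the generalized Hukuhara difference. -/
theorem gHSub_eq_iff (Q R P : NonemptyInterval ℝ) :
    gHSub Q R = P ↔ Q = R + P ∨ R = Q - P := by
  obtain ⟨⟨q₁, q₂⟩, hq⟩ := Q
  obtain ⟨⟨r₁, r₂⟩, hr⟩ := R
  obtain ⟨⟨p₁, p₂⟩, hp⟩ := P
  simp only at hq hr hp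
  simp only [gHSub, NonemptyInterval.ext_iff, Prod.ext_iff, NonemptyInterval.toProd_add,
    NonemptyInterval.fst_sub, NonemptyInterval.snd_sub, Prod.fst_add, Prod.snd_add]
  constructor
  · rintro ⟨h₁, h₂⟩
    rcases le_total (q₁ - r₁) (q₂ - r₂) with h | h
    · rw [min_eq_left h] at h₁
      rw [max_eq_right h] at h₂
      left
      constructor <;> linarith
    · rw [min_eq_right h] at h₁
      rw [max_eq_left h] at h₂
      right
      constructor <;> linarith
  · rintro (⟨h₁, h₂⟩ | ⟨h₁, h₂⟩)
    · rw [min_eq_left (by linarith), max_eq_right (by linarith)]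
      constructor <;> linarith
    · rw [min_eq_right (by linarith), max_eq_left (by linarith)]
      constructor <;> linarith

/-! ### Nonsmooth analysis on Euclidean space -/

/-- Local Lipschitz continuity of an interval-valued function on `ℝⁿ`. -/
def LocallyLipschitzIVF {n : ℕ} (f : EuclideanSpace ℝ (Fin n) → NonemptyInterval ℝ) : Prop :=
  ∀ u₀ : EuclideanSpace ℝ (Fin n), ∃ U ∈ 𝓝 u₀, ∃ L : ℝ, 0 < L ∧
    ∀ u₁ ∈ U, ∀ u₂ ∈ U, ivNorm (gHSub (f u₁) (f u₂)) ≤ L * ‖u₁ - u₂‖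

/-- The Clarke directional derivative
`ψ⁰(z; w) = limsup_{u → z, t → 0⁺} (ψ (u + t w) - ψ u) / t` of a locally Lipschitz function. For
such `ψ` the difference quotients are bounded near `(z, 0⁺)`, so this real `limsup` is the usual
one. -/
def clarkeDeriv {n : ℕ} (ψ : EuclideanSpace ℝ (Fin n) → ℝ) (z w : EuclideanSpace ℝ (Fin n)) : ℝ :=
  Filter.limsup
    (fun q : EuclideanSpace ℝ (Fin n) × ℝ => (ψ (q.1 + q.2 • w) - ψ q.1) / q.2)
    (𝓝 z ×ˢ 𝓝[>] (0 : ℝ))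

/-- The Clarke generalized gradient of a locally Lipschitz function. -/
def clarkeGradient {n : ℕ} (ψ : EuclideanSpace ℝ (Fin n) → ℝ) (z : EuclideanSpace ℝ (Fin n)) :
    Set (EuclideanSpace ℝ (Fin n)) :=
  {ξ | ∀ w : EuclideanSpace ℝ (Fin n), inner ℝ ξ w ≤ clarkeDeriv ψ z w}

/-- The weakly generalized gradient of a locally Lipschitz interval-valued function: the convex
hull of the union of the generalized gradients of its center and width functions. -/
def weakGradient {n : ℕ} (f : EuclideanSpace ℝ (Fin n) → NonemptyInterval ℝ)
    (u : EuclideanSpace ℝ (Fin n)) : Set (EuclideanSpace ℝ (Fin n)) :=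
  convexHull ℝ
    (clarkeGradient (fun v => center (f v)) u ∪ clarkeGradient (fun v => width (f v)) u)

/-! ### The optimization problem -/

/-- The feasible set `{u | g_j(u) ≤ 0 for all j}`. -/
def feasibleSet {n p : ℕ} (g : Fin p → EuclideanSpace ℝ (Fin n) → ℝ) :
    Set (EuclideanSpace ℝ (Fin n)) :=
  {u | ∀ j, g j u ≤ 0}

/-- The indices of the constraints that are active at `u`. -/
def activeSet {n p : ℕ} (g : Fin p → EuclideanSpace ℝ (Fin n) → ℝ)
    (u : EuclideanSpace ℝ (Fin n)) : Finset (Fin p) :=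
  Finset.univ.filter fun j => g j u = 0

/-- The interval `[0, r]` for `r ≥ 0`. -/
def zeroTo (r : ℝ≥0) : NonemptyInterval ℝ := ⟨(0, (r : ℝ)), r.coe_nonneg⟩

/-- The set of (global) weak `ε`-quasi-minimal solutions on `S` of the multiobjective
interval-valued problem with objectives `F k`: the points `z₀ ∈ S` such that no `z ∈ S` satisfies
`F k z + [0, ε k * ‖z - z₀‖] ≺ F k z₀` for all `k`. -/
def quasiMinimalSet {n m : ℕ} (F : Fin m → EuclideanSpace ℝ (Fin n) → NonemptyInterval ℝ)
    (S : Set (EuclideanSpace ℝ (Fin n))) (ε : Fin m → ℝ≥0) : Set (EuclideanSpace ℝ (Fin n)) :=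
  {z₀ | z₀ ∈ S ∧ ¬ ∃ z ∈ S, ∀ k, CWLt (F k z + zeroTo (ε k * ‖z - z₀‖₊)) (F k z₀)}

/-- The basic constraint qualification at `u`: there is no nonzero `μ ≥ 0`, vanishing at all
inactive constraints, with `0 ∈ ∑ j, μ j • ∂⁰ g_j(u)` (a Minkowski sum). -/
def BCQ {n p : ℕ} (g : Fin p → EuclideanSpace ℝ (Fin n) → ℝ)
    (u : EuclideanSpace ℝ (Fin n)) : Prop :=
  ¬ ∃ μ : Fin p → ℝ, (∀ j, 0 ≤ μ j) ∧ μ ≠ 0 ∧ (∀ j, j ∉ activeSet g u → μ j = 0) ∧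
    (0 : EuclideanSpace ℝ (Fin n)) ∈ ∑ j, μ j • clarkeGradient (g j) u

end MIOP

end

/-! Suppose that in some direction `w` the Clarke derivatives of all active constraints are
negative, and so are those of all centers and widths after adding `ε k / 2 * ‖w‖`. A short step
along `w` then reaches a feasible point that beats `ubar`, so no such `w` exists
(`not_exists_common_descent`). By Hahn–Banach each of these expressions is the attained support
function of a compact convex set: a Clarke gradient, plus a ball of radius `ε k / 2` for the
objectives. Hence every direction has a nonnegative inner product with a member of one of the sets,
and separation puts `0` in the convex hull of their union. These are Fritz John multipliers
(`exists_fritzJohn`). BCQ prevents the objective weights from all vanishing; merging the center and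
width weights of each `F k` and normalising gives `lam`. -/

namespace MIOP

open Filter

/-! ### Clarke derivative and Clarke gradient -/

section Gradient

variable {n : ℕ}

/-- The difference quotient in the definition of the Clarke derivative. -/
noncomputable def diffQuot (ψ : EuclideanSpace ℝ (Fin n) → ℝ) (w : EuclideanSpace ℝ (Fin n))
    (q : EuclideanSpace ℝ (Fin n) × ℝ) : ℝ :=
  (ψ (q.1 + q.2 • w) - ψ q.1) / q.2

theorem tendsto_add_smul_clarke (z w : EuclideanSpace ℝ (Fin n)) :
    Tendsto (fun q : EuclideanSpace ℝ (Fin n) × ℝ => q.1 + q.2 • w)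
      (𝓝 z ×ˢ 𝓝[>] (0 : ℝ)) (𝓝 z) := by
  have h : Tendsto (fun q : EuclideanSpace ℝ (Fin n) × ℝ => q.1 + q.2 • w)
      (𝓝 z ×ˢ 𝓝 (0 : ℝ)) (𝓝 z) := by
    rw [← nhds_prod_eq]
    have : Continuous (fun q : EuclideanSpace ℝ (Fin n) × ℝ => q.1 + q.2 • w) := by fun_prop
    simpa using this.tendsto (z, (0 : ℝ))
  exact h.mono_left (Filter.prod_mono le_rfl nhdsWithin_le_nhds)

theorem eventually_snd_pos (z : EuclideanSpace ℝ (Fin n)) :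
    ∀ᶠ q : EuclideanSpace ℝ (Fin n) × ℝ in 𝓝 z ×ˢ 𝓝[>] (0 : ℝ), 0 < q.2 :=
  tendsto_snd.eventually (self_mem_nhdsWithin : ∀ᶠ t in 𝓝[>] (0 : ℝ), t ∈ Set.Ioi 0)

/-- A real `limsup` carries information only for bounded quotients; the local Lipschitz constant
bounds them on both sides, with one `K` for all `w`. -/
theorem exists_eventually_abs_diffQuot_le {ψ : EuclideanSpace ℝ (Fin n) → ℝ}
    (hψ : LocallyLipschitz ψ) (z : EuclideanSpace ℝ (Fin n)) :
    ∃ K : ℝ≥0, ∀ w, ∀ᶠ q in 𝓝 z ×ˢ 𝓝[>] (0 : ℝ), |diffQuot ψ w q| ≤ K * ‖w‖ := by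
  obtain ⟨K, t, ht, hK⟩ := hψ z
  refine ⟨K, fun w => ?_⟩
  filter_upwards [(tendsto_add_smul_clarke z w).eventually ht,
    (tendsto_fst (f := 𝓝 z) (g := 𝓝[>] (0 : ℝ))).eventually ht, eventually_snd_pos z]
    with q h₁ h₂ h₃
  have h := hK.dist_le_mul _ h₁ _ h₂
  rw [Real.dist_eq, dist_eq_norm, add_sub_cancel_left, norm_smul, Real.norm_eq_abs,
    abs_of_pos h₃] at h
  rw [diffQuot, abs_div, abs_of_pos h₃, div_le_iff₀ h₃]
  linarith

theorem eventually_diffQuot_lt {ψ : EuclideanSpace ℝ (Fin n) → ℝ} (hψ : LocallyLipschitz ψ)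
    (z : EuclideanSpace ℝ (Fin n))
    {w : EuclideanSpace ℝ (Fin n)} {b : ℝ} (h : clarkeDeriv ψ z w < b) :
    ∀ᶠ q in 𝓝 z ×ˢ 𝓝[>] (0 : ℝ), diffQuot ψ w q < b := by
  obtain ⟨K, hK⟩ := exists_eventually_abs_diffQuot_le hψ z
  exact eventually_lt_of_limsup_lt h
    ⟨K * ‖w‖, (hK w).mono fun q hq => (abs_le.1 hq).2⟩

theorem clarkeDeriv_le {ψ : EuclideanSpace ℝ (Fin n) → ℝ} (hψ : LocallyLipschitz ψ)
    (z : EuclideanSpace ℝ (Fin n))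
    {w : EuclideanSpace ℝ (Fin n)} {b : ℝ}
    (h : ∀ᶠ q in 𝓝 z ×ˢ 𝓝[>] (0 : ℝ), diffQuot ψ w q ≤ b) : clarkeDeriv ψ z w ≤ b := by
  obtain ⟨K, hK⟩ := exists_eventually_abs_diffQuot_le hψ z
  refine limsup_le_of_le (IsBoundedUnder.isCoboundedUnder_le
    ⟨-(K * ‖w‖), eventually_map.2 ?_⟩) h
  exact (hK w).mono fun q hq => (abs_le.1 hq).1

theorem exists_clarkeDeriv_le_mul_norm {ψ : EuclideanSpace ℝ (Fin n) → ℝ} (hψ : LocallyLipschitz ψ)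
    (z : EuclideanSpace ℝ (Fin n)) : ∃ K : ℝ≥0, ∀ w, clarkeDeriv ψ z w ≤ K * ‖w‖ := by
  obtain ⟨K, hK⟩ := exists_eventually_abs_diffQuot_le hψ z
  exact ⟨K, fun w => clarkeDeriv_le hψ z ((hK w).mono fun q hq => (abs_le.1 hq).2)⟩

theorem clarkeDeriv_add_le {ψ : EuclideanSpace ℝ (Fin n) → ℝ} (hψ : LocallyLipschitz ψ)
    (z : EuclideanSpace ℝ (Fin n))
    (v w : EuclideanSpace ℝ (Fin n)) :
    clarkeDeriv ψ z (v + w) ≤ clarkeDeriv ψ z v + clarkeDeriv ψ z w := by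
  refine le_of_forall_pos_le_add fun δ hδ => clarkeDeriv_le hψ z ?_
  have hv := eventually_diffQuot_lt hψ z (w := v) (b := clarkeDeriv ψ z v + δ / 2) (by linarith)
  have hw := eventually_diffQuot_lt hψ z (w := w) (b := clarkeDeriv ψ z w + δ / 2) (by linarith)
  have hs : Tendsto (fun q : EuclideanSpace ℝ (Fin n) × ℝ => (q.1 + q.2 • w, q.2))
      (𝓝 z ×ˢ 𝓝[>] (0 : ℝ))
      (𝓝 z ×ˢ 𝓝[>] (0 : ℝ)) := (tendsto_add_smul_clarke z w).prodMk tendsto_snd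
  filter_upwards [hs.eventually hv, hw] with q h₁ h₂
  -- The quotient along `v` is taken at the shifted base point `q.1 + q.2 • w`, which still tends to
  -- `z`; a limsup over moving base points absorbs the shift.
  have : diffQuot ψ (v + w) q = diffQuot ψ v (q.1 + q.2 • w, q.2) + diffQuot ψ w q := by
    simp only [diffQuot]
    rw [← add_div, show q.1 + q.2 • w + q.2 • v = q.1 + q.2 • (v + w) by rw [smul_add]; abel]
    ring
  linarith

theorem clarkeDeriv_smul_le {ψ : EuclideanSpace ℝ (Fin n) → ℝ} (hψ : LocallyLipschitz ψ)
    (z : EuclideanSpace ℝ (Fin n))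
    {c : ℝ} (hc : 0 < c) (w : EuclideanSpace ℝ (Fin n)) :
    clarkeDeriv ψ z (c • w) ≤ c * clarkeDeriv ψ z w := by
  refine le_of_forall_pos_le_add fun δ hδ => clarkeDeriv_le hψ z ?_
  have hw := eventually_diffQuot_lt hψ z (w := w) (b := clarkeDeriv ψ z w + δ / c)
    (by linarith [div_pos hδ hc])
  have hm : Tendsto (fun t : ℝ => t * c) (𝓝[>] (0 : ℝ)) (𝓝[>] (0 : ℝ)) := by
    refine tendsto_nhdsWithin_iff.2 ⟨?_, ?_⟩
    · have : Continuous fun t : ℝ => t * c := by fun_prop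
      simpa using (this.tendsto 0).mono_left nhdsWithin_le_nhds
    · filter_upwards [self_mem_nhdsWithin] with t ht using mul_pos ht hc
  have hs : Tendsto (fun q : EuclideanSpace ℝ (Fin n) × ℝ => (q.1, q.2 * c))
      (𝓝 z ×ˢ 𝓝[>] (0 : ℝ))
      (𝓝 z ×ˢ 𝓝[>] (0 : ℝ)) := tendsto_fst.prodMk (hm.comp tendsto_snd)
  filter_upwards [hs.eventually hw, eventually_snd_pos z] with q h₁ h₂
  have h₃ : diffQuot ψ (c • w) q = c * diffQuot ψ w (q.1, q.2 * c) := by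
    simp only [diffQuot, smul_smul]
    field_simp
  rw [h₃, show c * clarkeDeriv ψ z w + δ = c * (clarkeDeriv ψ z w + δ / c) by field_simp]
  exact mul_le_mul_of_nonneg_left h₁.le hc.le

theorem clarkeDeriv_smul {ψ : EuclideanSpace ℝ (Fin n) → ℝ} (hψ : LocallyLipschitz ψ)
    (z : EuclideanSpace ℝ (Fin n))
    {c : ℝ} (hc : 0 < c) (w : EuclideanSpace ℝ (Fin n)) :
    clarkeDeriv ψ z (c • w) = c * clarkeDeriv ψ z w := by
  refine (clarkeDeriv_smul_le hψ z hc w).antisymm ?_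
  have h := clarkeDeriv_smul_le hψ z (inv_pos.2 hc) (c • w)
  rwa [smul_smul, inv_mul_cancel₀ hc.ne', one_smul, inv_mul_eq_div, le_div_iff₀' hc] at h

theorem clarkeDeriv_zero {ψ : EuclideanSpace ℝ (Fin n) → ℝ} (hψ : LocallyLipschitz ψ)
    (z : EuclideanSpace ℝ (Fin n)) : clarkeDeriv ψ z 0 = 0 := by
  have h := clarkeDeriv_smul hψ z (c := 2) (by norm_num) 0
  rw [smul_zero] at h
  linarith

/-- This is the domination on the line through `w` that Hahn–Banach requires. For `c < 0` it follows
from subadditivity applied to `c • w` and `-c • w`. -/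
theorem mul_clarkeDeriv_le {ψ : EuclideanSpace ℝ (Fin n) → ℝ} (hψ : LocallyLipschitz ψ)
    (z : EuclideanSpace ℝ (Fin n))
    (c : ℝ) (w : EuclideanSpace ℝ (Fin n)) :
    c * clarkeDeriv ψ z w ≤ clarkeDeriv ψ z (c • w) := by
  rcases lt_trichotomy c 0 with hc | rfl | hc
  · have h₁ := clarkeDeriv_add_le hψ z (c • w) ((-c) • w)
    rw [← add_smul, add_neg_cancel, zero_smul, clarkeDeriv_zero hψ,
      clarkeDeriv_smul hψ z (neg_pos.2 hc)] at h₁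
    linarith
  · simp [clarkeDeriv_zero hψ]
  · exact (clarkeDeriv_smul hψ z hc w).ge

/-- A linear functional below the Clarke derivative is given by a Clarke subgradient. -/
theorem exists_mem_clarkeGradient_of_partial {ψ : EuclideanSpace ℝ (Fin n) → ℝ} (hψ : LocallyLipschitz ψ)
    (z : EuclideanSpace ℝ (Fin n))
    (f : EuclideanSpace ℝ (Fin n) →ₗ.[ℝ] ℝ)
    (hf : ∀ x : f.domain, f x ≤ clarkeDeriv ψ z x) :
    ∃ ξ ∈ clarkeGradient ψ z, ∀ x : f.domain, inner ℝ ξ (x : EuclideanSpace ℝ (Fin n)) = f x := by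
  obtain ⟨l, h₁, h₂⟩ := exists_extension_of_le_sublinear f (clarkeDeriv ψ z)
    (fun c hc x => clarkeDeriv_smul hψ z hc x) (clarkeDeriv_add_le hψ z) hf
  have h : ∀ x, inner ℝ ((InnerProductSpace.toDual ℝ (EuclideanSpace ℝ (Fin n))).symm
      (LinearMap.toContinuousLinearMap l)) x = l x := fun x => by simp
  exact ⟨_, fun w => (h w).trans_le (h₂ w), fun x => (h x).trans (h₁ x)⟩

/-- The functional `c • w ↦ c * clarkeDeriv ψ z w` on the span of `w` extends under the sublinear
map `clarkeDeriv ψ z`, so the support function of the gradient is attained. -/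
theorem exists_mem_clarkeGradient_inner_eq {ψ : EuclideanSpace ℝ (Fin n) → ℝ} (hψ : LocallyLipschitz ψ)
    (z : EuclideanSpace ℝ (Fin n))
    (w : EuclideanSpace ℝ (Fin n)) :
    ∃ ξ ∈ clarkeGradient ψ z, inner ℝ ξ w = clarkeDeriv ψ z w := by
  by_cases hw : w = 0
  · obtain ⟨ξ, hξ, -⟩ := exists_mem_clarkeGradient_of_partial hψ z ⊥ (by
      rintro ⟨x, hx⟩
      obtain rfl : x = 0 := (Submodule.mem_bot ℝ).1 hx
      exact (LinearPMap.map_zero _).trans_le (clarkeDeriv_zero hψ z).ge)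
    exact ⟨ξ, hξ, by rw [hw, inner_zero_right, clarkeDeriv_zero hψ]⟩
  · obtain ⟨ξ, hξ, h⟩ := exists_mem_clarkeGradient_of_partial hψ z
      (LinearPMap.mkSpanSingleton w (clarkeDeriv ψ z w) hw) (by
      rintro ⟨x, hx⟩
      obtain ⟨c, rfl⟩ := Submodule.mem_span_singleton.1 hx
      rw [LinearPMap.mkSpanSingleton'_apply]
      exact mul_clarkeDeriv_le hψ z c w)
    refine ⟨ξ, hξ, (h ⟨w, Submodule.mem_span_singleton_self w⟩).trans ?_⟩
    exact LinearPMap.mkSpanSingleton'_apply_self ..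

theorem clarkeGradient_nonempty {ψ : EuclideanSpace ℝ (Fin n) → ℝ} (hψ : LocallyLipschitz ψ)
    (z : EuclideanSpace ℝ (Fin n)) : (clarkeGradient ψ z).Nonempty :=
  let ⟨ξ, hξ, _⟩ := exists_mem_clarkeGradient_inner_eq hψ z 0
  ⟨ξ, hξ⟩

theorem isCompact_clarkeGradient {ψ : EuclideanSpace ℝ (Fin n) → ℝ} (hψ : LocallyLipschitz ψ)
    (z : EuclideanSpace ℝ (Fin n)) : IsCompact (clarkeGradient ψ z) := by
  obtain ⟨K, hK⟩ := exists_clarkeDeriv_le_mul_norm hψ z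
  refine Metric.isCompact_of_isClosed_isBounded ?_ ?_
  · rw [clarkeGradient, Set.ofPred_forall]
    exact isClosed_iInter fun w => isClosed_le (by fun_prop) continuous_const
  · refine isBounded_iff_forall_norm_le.2 ⟨K, fun ξ hξ => ?_⟩
    have h := (hξ ξ).trans (hK ξ)
    rw [real_inner_self_eq_norm_mul_norm] at h
    rcases (norm_nonneg ξ).eq_or_lt with h₀ | h₀
    · exact h₀ ▸ K.2
    · exact le_of_mul_le_mul_right h h₀

theorem convex_clarkeGradient {ψ : EuclideanSpace ℝ (Fin n) → ℝ} (z : EuclideanSpace ℝ (Fin n)) :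
    Convex ℝ (clarkeGradient ψ z) := by
  intro x hx y hy a b ha hb hab w
  rw [inner_add_left, real_inner_smul_left, real_inner_smul_left]
  calc a * inner ℝ x w + b * inner ℝ y w ≤ a * clarkeDeriv ψ z w + b * clarkeDeriv ψ z w :=
        add_le_add (mul_le_mul_of_nonneg_left (hx w) ha) (mul_le_mul_of_nonneg_left (hy w) hb)
    _ = clarkeDeriv ψ z w := by rw [← add_mul, hab, one_mul]

/-- A negative Clarke derivative of `ψ` perturbed by `c * ‖· - z‖` yields a descent direction. -/
theorem eventually_add_norm_lt_of_clarkeDeriv {ψ : EuclideanSpace ℝ (Fin n) → ℝ} (hψ : LocallyLipschitz ψ)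
    (z : EuclideanSpace ℝ (Fin n))
    {w : EuclideanSpace ℝ (Fin n)} {c : ℝ}
    (h : clarkeDeriv ψ z w + c * ‖w‖ < 0) :
    ∀ᶠ t in 𝓝[>] (0 : ℝ), ψ (z + t • w) + c * ‖t • w‖ < ψ z := by
  have h₁ := eventually_diffQuot_lt hψ z (w := w) (b := -(c * ‖w‖)) (by linarith)
  have hs : Tendsto (fun t : ℝ => (z, t)) (𝓝[>] (0 : ℝ)) (𝓝 z ×ˢ 𝓝[>] (0 : ℝ)) :=
    tendsto_const_nhds.prodMk tendsto_id
  filter_upwards [hs.eventually h₁, self_mem_nhdsWithin] with t ht (ht₀ : 0 < t)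
  rw [diffQuot, div_lt_iff₀ ht₀] at ht
  rw [norm_smul, Real.norm_eq_abs, abs_of_pos ht₀]
  simp only at ht
  linarith

end Gradient

/-! ### Separation for a family of compact convex sets -/

/-- Compact convex sets such that every direction has a nonnegative inner product with a member of
one of them have `0` as a convex combination of members. -/
theorem exists_sum_smul_eq_zero_of_forall_exists_inner_nonneg {n : ℕ} {ι : Type*} [Fintype ι]
    (C : ι → Set (EuclideanSpace ℝ (Fin n))) (hconv : ∀ i, Convex ℝ (C i))
    (hcomp : ∀ i, IsCompact (C i)) (h : ∀ w, ∃ i, ∃ x ∈ C i, 0 ≤ inner ℝ x w)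
    (hne : ∀ i, (C i).Nonempty) :
    ∃ (a : ι → ℝ) (x : ι → EuclideanSpace ℝ (Fin n)), (∀ i, 0 ≤ a i) ∧ ∑ i, a i = 1 ∧
      (∀ i, x i ∈ C i) ∧ ∑ i, a i • x i = 0 := by
  classical
  let T := (fun q : (ι → ℝ) × (ι → EuclideanSpace ℝ (Fin n)) => ∑ i, q.1 i • q.2 i) ''
    (stdSimplex ℝ ι ×ˢ Set.univ.pi C)
  have hT : IsCompact T :=
    ((isCompact_stdSimplex ℝ ι).prod (isCompact_univ_pi hcomp)).image (by fun_prop)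
  have hTc : Convex ℝ T := by
    -- Weights mix linearly; within each `C i`, convexity collapses the two weighted points into one
    -- point carrying the total weight.
    rintro _ ⟨⟨a, x⟩, ⟨ha, hx⟩, rfl⟩ _ ⟨⟨b, y⟩, ⟨hb, hy⟩, rfl⟩ s t hs ht hst
    have hz : ∀ i, ∃ v ∈ C i, (s * a i + t * b i) • v = (s * a i) • x i + (t * b i) • y i :=
      fun i => (hconv i).exists_mem_add_smul_eq (hx i trivial) (hy i trivial)
        (mul_nonneg hs (ha.1 i)) (mul_nonneg ht (hb.1 i))
    choose v hv hveq using hz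
    refine ⟨(fun i => s * a i + t * b i, v), ⟨convex_stdSimplex ℝ ι ha hb hs ht hst,
      fun i _ => hv i⟩, ?_⟩
    simp only [hveq, Finset.sum_add_distrib, Finset.smul_sum, smul_smul]
  by_cases h₀ : (0 : EuclideanSpace ℝ (Fin n)) ∈ T
  · obtain ⟨⟨a, x⟩, ⟨ha, hx⟩, h₁⟩ := h₀
    exact ⟨a, x, ha.1, ha.2, fun i => hx i trivial, h₁⟩
  -- The separating `f` is negative on `T`, hence on every `C i`, contradicting `h` in the direction
  -- representing `f`.
  · obtain ⟨f, u, hf, hu⟩ := geometric_hahn_banach_closed_point hTc hT.isClosed h₀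
    obtain ⟨i, x, hx, hxi⟩ := h ((InnerProductSpace.toDual ℝ _).symm f)
    choose y hy using hne
    have hmem : x ∈ T := by
      refine ⟨(Pi.single i 1, Function.update y i x), ⟨single_mem_stdSimplex ℝ i, ?_⟩, ?_⟩
      · intro j _
        rcases eq_or_ne j i with rfl | hj
        · simpa using hx
        · simpa [hj] using hy j
      · simp [Pi.single_apply, ite_smul]
    have h₂ := hf x hmem
    rw [map_zero] at hu
    rw [real_inner_comm, InnerProductSpace.toDual_symm_apply] at hxi
    linarith

/-! ### Interval-valued functions -/

theorem abs_sub_le_of_ivNorm_gHSub_le {Q R : NonemptyInterval ℝ} {r : ℝ}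
    (h : ivNorm (gHSub Q R) ≤ r) : |Q.fst - R.fst| ≤ r ∧ |Q.snd - R.snd| ≤ r := by
  obtain ⟨h₁, h₂⟩ := max_le_iff.1 h
  simp only [gHSub] at h₁ h₂
  rw [abs_le] at h₁ h₂ ⊢
  rw [abs_le]
  have := min_le_left (Q.fst - R.fst) (Q.snd - R.snd)
  have := min_le_right (Q.fst - R.fst) (Q.snd - R.snd)
  have := le_max_left (Q.fst - R.fst) (Q.snd - R.snd)
  have := le_max_right (Q.fst - R.fst) (Q.snd - R.snd)
  refine ⟨⟨?_, ?_⟩, ?_, ?_⟩ <;> linarith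

theorem LocallyLipschitzIVF.comp_of_abs_le {n : ℕ}
    {f : EuclideanSpace ℝ (Fin n) → NonemptyInterval ℝ} (hf : LocallyLipschitzIVF f)
    {φ : NonemptyInterval ℝ → ℝ}
    (hφ : ∀ Q R r, |Q.fst - R.fst| ≤ r → |Q.snd - R.snd| ≤ r → |φ Q - φ R| ≤ r) :
    LocallyLipschitz fun v => φ (f v) := by
  intro u
  obtain ⟨U, hU, L, hL, h⟩ := hf u
  refine ⟨L.toNNReal, U, hU, LipschitzOnWith.of_dist_le_mul fun x hx y hy => ?_⟩
  rw [Real.dist_eq, dist_eq_norm, Real.coe_toNNReal _ hL.le]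
  obtain ⟨h₁, h₂⟩ := abs_sub_le_of_ivNorm_gHSub_le (h x hx y hy)
  exact hφ _ _ _ h₁ h₂

theorem LocallyLipschitzIVF.center {n : ℕ} {f : EuclideanSpace ℝ (Fin n) → NonemptyInterval ℝ}
    (hf : LocallyLipschitzIVF f) : LocallyLipschitz fun v => center (f v) :=
  hf.comp_of_abs_le fun Q R r h₁ h₂ => by
    rw [abs_le] at *
    constructor <;> simp only [MIOP.center] <;> linarith

theorem LocallyLipschitzIVF.width {n : ℕ} {f : EuclideanSpace ℝ (Fin n) → NonemptyInterval ℝ}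
    (hf : LocallyLipschitzIVF f) : LocallyLipschitz fun v => width (f v) :=
  hf.comp_of_abs_le fun Q R r h₁ h₂ => by
    rw [abs_le] at *
    constructor <;> simp only [MIOP.width] <;> linarith

/-- Adding `[0, r]` raises center and width by `r / 2` each, which is where the radii `ε k / 2` come
from. -/
theorem cwLt_add_zeroTo_iff {Q R : NonemptyInterval ℝ} {r : ℝ≥0} :
    CWLt (Q + zeroTo r) R ↔ center Q + r / 2 < center R ∧ width Q + r / 2 < width R := by
  simp only [CWLt, center, width, NonemptyInterval.toProd_add, Prod.fst_add, Prod.snd_add, zeroTo]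
  constructor <;> rintro ⟨h₁, h₂⟩ <;> constructor <;> linarith

/-- The primal first-order condition: at a quasi-minimal solution no direction is a strict descent
direction for all perturbed centers and widths and all active constraints. -/
theorem not_exists_common_descent {n m p : ℕ}
    {F : Fin m → EuclideanSpace ℝ (Fin n) → NonemptyInterval ℝ}
    {g : Fin p → EuclideanSpace ℝ (Fin n) → ℝ}
    (hF : ∀ k, LocallyLipschitzIVF (F k)) (hg : ∀ j, LocallyLipschitz (g j))
    {ε : Fin m → ℝ≥0} {u : EuclideanSpace ℝ (Fin n)}
    (hu : u ∈ quasiMinimalSet F (feasibleSet g) ε) (w : EuclideanSpace ℝ (Fin n)) :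
    ¬ ((∀ k, clarkeDeriv (fun v => center (F k v)) u w + ε k / 2 * ‖w‖ < 0) ∧
      (∀ k, clarkeDeriv (fun v => width (F k v)) u w + ε k / 2 * ‖w‖ < 0) ∧
      ∀ j ∈ activeSet g u, clarkeDeriv (g j) u w < 0) := by
  rintro ⟨hc, hw, ha⟩
  have h₁ := eventually_all.2 fun k =>
    eventually_add_norm_lt_of_clarkeDeriv (hF k).center u (hc k)
  have h₂ := eventually_all.2 fun k =>
    eventually_add_norm_lt_of_clarkeDeriv (hF k).width u (hw k)
  have h₃ : ∀ᶠ t in 𝓝[>] (0 : ℝ), ∀ j, g j (u + t • w) ≤ 0 := by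
    refine eventually_all.2 fun j => ?_
    by_cases hj : j ∈ activeSet g u
    · have h := eventually_add_norm_lt_of_clarkeDeriv (hg j) u (w := w) (c := 0)
        (by simpa using ha j hj)
      have h₀ : g j u = 0 := (Finset.mem_filter.1 hj).2
      filter_upwards [h] with t ht
      rw [h₀, zero_mul, add_zero] at ht
      exact ht.le
    · have h₀ : g j u < 0 := lt_of_le_of_ne (hu.1 j) fun h => hj (by simp [activeSet, h])
      have hcont : Continuous fun t : ℝ => g j (u + t • w) :=
        (hg j).continuous.comp (by fun_prop)
      have h : ∀ᶠ t in 𝓝 (0 : ℝ), g j (u + t • w) < 0 :=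
        hcont.continuousAt.eventually_lt continuousAt_const (by simpa using h₀)
      exact (h.filter_mono nhdsWithin_le_nhds).mono fun t ht => ht.le
  obtain ⟨t, h₁, h₂, h₃⟩ := (h₁.and (h₂.and h₃)).exists
  refine hu.2 ⟨u + t • w, h₃, fun k => cwLt_add_zeroTo_iff.2 ?_⟩
  have e₁ := h₁ k
  have e₂ := h₂ k
  simp only [NNReal.coe_mul, coe_nnnorm, add_sub_cancel_left]
  constructor <;> linarith

/-! ### Perturbed gradients and multipliers -/

/-- The subdifferential of the perturbation of `ψ` by `c * ‖· - z‖`. -/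
noncomputable def perturbedGradient {n : ℕ} (ψ : EuclideanSpace ℝ (Fin n) → ℝ) (z : EuclideanSpace ℝ (Fin n))
    (c : ℝ≥0) : Set (EuclideanSpace ℝ (Fin n)) :=
  clarkeGradient ψ z + Metric.closedBall 0 c

theorem exists_mem_perturbedGradient_inner_eq {n : ℕ} {ψ : EuclideanSpace ℝ (Fin n) → ℝ}
    (hψ : LocallyLipschitz ψ) (z : EuclideanSpace ℝ (Fin n)) (c : ℝ≥0)
    (w : EuclideanSpace ℝ (Fin n)) :
    ∃ ξ ∈ perturbedGradient ψ z c, inner ℝ ξ w = clarkeDeriv ψ z w + c * ‖w‖ := by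
  obtain ⟨ξ, hξ, h⟩ := exists_mem_clarkeGradient_inner_eq hψ z w
  -- The ball maximises the inner product with `w` at its boundary point along `w`; for `w = 0` the
  -- quotient is `0` by convention.
  refine ⟨ξ + (c / ‖w‖) • w, Set.add_mem_add hξ ?_, ?_⟩
  · rw [mem_closedBall_zero_iff, norm_smul, Real.norm_eq_abs, abs_of_nonneg (by positivity)]
    rcases eq_or_ne w 0 with rfl | hw
    · simp
    · rw [div_mul_cancel₀ _ (norm_ne_zero_iff.2 hw)]
  · rw [inner_add_left, h, real_inner_smul_left, real_inner_self_eq_norm_mul_norm]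
    rcases eq_or_ne w 0 with rfl | hw
    · simp
    · have := norm_ne_zero_iff.2 hw
      field_simp

/-- Fritz John multipliers at a quasi-minimal solution. -/
theorem exists_fritzJohn {n m p : ℕ}
    {F : Fin m → EuclideanSpace ℝ (Fin n) → NonemptyInterval ℝ}
    {g : Fin p → EuclideanSpace ℝ (Fin n) → ℝ}
    (hF : ∀ k, LocallyLipschitzIVF (F k)) (hg : ∀ j, LocallyLipschitz (g j))
    {ε : Fin m → ℝ≥0} {u : EuclideanSpace ℝ (Fin n)}
    (hu : u ∈ quasiMinimalSet F (feasibleSet g) ε) :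
    ∃ (a b : Fin m → ℝ) (μ : Fin p → ℝ) (x y : Fin m → EuclideanSpace ℝ (Fin n))
      (v : Fin p → EuclideanSpace ℝ (Fin n)),
      (∀ k, 0 ≤ a k) ∧ (∀ k, 0 ≤ b k) ∧ (∀ j, 0 ≤ μ j) ∧
      ∑ k, a k + ∑ k, b k + ∑ j, μ j = 1 ∧ (∀ j ∉ activeSet g u, μ j = 0) ∧
      (∀ k, x k ∈ perturbedGradient (fun v => center (F k v)) u (ε k / 2)) ∧
      (∀ k, y k ∈ perturbedGradient (fun v => width (F k v)) u (ε k / 2)) ∧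
      (∀ j, v j ∈ clarkeGradient (g j) u) ∧
      ∑ k, a k • x k + ∑ k, b k • y k + ∑ j, μ j • v j = 0 := by
  classical
  have key : ∀ {ψ : EuclideanSpace ℝ (Fin n) → ℝ}, LocallyLipschitz ψ → ∀ c,
      Convex ℝ (perturbedGradient ψ u c) ∧ IsCompact (perturbedGradient ψ u c) ∧
        (perturbedGradient ψ u c).Nonempty := fun hψ c =>
    ⟨(convex_clarkeGradient u).add (convex_closedBall _ _),
      (isCompact_clarkeGradient hψ u).add (isCompact_closedBall _ _),
      (clarkeGradient_nonempty hψ u).add (Metric.nonempty_closedBall.2 c.2)⟩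
  let C : Fin m ⊕ Fin m ⊕ activeSet g u → Set (EuclideanSpace ℝ (Fin n)) :=
    Sum.elim (fun k => perturbedGradient (fun v => center (F k v)) u (ε k / 2))
      (Sum.elim (fun k => perturbedGradient (fun v => width (F k v)) u (ε k / 2))
        fun j => clarkeGradient (g j) u)
  have hdir : ∀ w, ∃ i, ∃ x ∈ C i, 0 ≤ inner ℝ x w := by
    intro w
    by_contra! h
    refine not_exists_common_descent hF hg hu w ⟨fun k => ?_, fun k => ?_, fun j hj => ?_⟩
    · obtain ⟨ξ, hξ, e⟩ := exists_mem_perturbedGradient_inner_eq (hF k).center u (ε k / 2) w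
      have := h (Sum.inl k) ξ hξ
      rw [e] at this
      simpa using this
    · obtain ⟨ξ, hξ, e⟩ := exists_mem_perturbedGradient_inner_eq (hF k).width u (ε k / 2) w
      have := h (Sum.inr (Sum.inl k)) ξ hξ
      rw [e] at this
      simpa using this
    · obtain ⟨ξ, hξ, e⟩ := exists_mem_clarkeGradient_inner_eq (hg j) u w
      exact e ▸ h (Sum.inr (Sum.inr ⟨j, hj⟩)) ξ hξ
  obtain ⟨r, x, hr, hsum, hx, h₀⟩ :=
    exists_sum_smul_eq_zero_of_forall_exists_inner_nonneg C
      (by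
        rintro (k | k | j)
        exacts [(key (hF k).center _).1, (key (hF k).width _).1, convex_clarkeGradient u])
      (by
        rintro (k | k | j)
        exacts [(key (hF k).center _).2.1, (key (hF k).width _).2.1,
          isCompact_clarkeGradient (hg j) u])
      hdir
      (by
        rintro (k | k | j)
        exacts [(key (hF k).center _).2.2, (key (hF k).width _).2.2,
          clarkeGradient_nonempty (hg j) u])
  -- Inactive constraints get weight `0` and an arbitrary subgradient, extending the family to all
  -- of `Fin p`.
  choose v₀ hv₀ using fun j => clarkeGradient_nonempty (hg j) u
  rw [Fintype.sum_sum_type, Fintype.sum_sum_type] at hsum h₀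
  let μ : Fin p → ℝ := fun j => if h : j ∈ activeSet g u then r (.inr (.inr ⟨j, h⟩)) else 0
  let v : Fin p → EuclideanSpace ℝ (Fin n) :=
    fun j => if h : j ∈ activeSet g u then x (.inr (.inr ⟨j, h⟩)) else v₀ j
  have hμ : ∀ j ∉ activeSet g u, μ j = 0 := fun j hj => dif_neg hj
  have e₁ : ∑ j : activeSet g u, r (.inr (.inr j)) = ∑ j, μ j := by
    rw [← Finset.sum_subset (Finset.subset_univ (activeSet g u)) fun j _ hj => hμ j hj,
      ← Finset.sum_coe_sort (activeSet g u)]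
    refine Finset.sum_congr rfl fun j _ => ?_
    simp only [μ, dif_pos j.2]
  have e₂ : ∑ j : activeSet g u, r (.inr (.inr j)) • x (.inr (.inr j)) = ∑ j, μ j • v j := by
    rw [← Finset.sum_subset (Finset.subset_univ (activeSet g u))
      fun j _ hj => by rw [hμ j hj, zero_smul], ← Finset.sum_coe_sort (activeSet g u)]
    refine Finset.sum_congr rfl fun j _ => ?_
    simp only [μ, v, dif_pos j.2]
  refine ⟨fun k => r (.inl k), fun k => r (.inr (.inl k)), μ, fun k => x (.inl k),
    fun k => x (.inr (.inl k)), v, fun k => hr _, fun k => hr _, fun j => ?_, ?_, hμ,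
    fun k => hx (.inl k), fun k => hx (.inr (.inl k)), fun j => ?_, ?_⟩
  · by_cases h : j ∈ activeSet g u
    · simpa [μ, h] using hr (.inr (.inr ⟨j, h⟩))
    · exact (hμ j h).ge
  · rw [← e₁, add_assoc]
    exact hsum
  · by_cases h : j ∈ activeSet g u
    · simp only [v, dif_pos h]
      exact hx (.inr (.inr ⟨j, h⟩))
    · simpa [v, h] using hv₀ j
  · rw [← e₂, add_assoc]
    exact h₀

/-- Multiples of perturbed gradients of center and width combine to a multiple of the weak gradient
and a multiple of the unit ball. -/
theorem smul_add_smul_mem_weakGradient_add_ball {n : ℕ}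
    {f : EuclideanSpace ℝ (Fin n) → NonemptyInterval ℝ} {u x y : EuclideanSpace ℝ (Fin n)}
    {c : ℝ≥0} (hx : x ∈ perturbedGradient (fun v => center (f v)) u (c / 2))
    (hy : y ∈ perturbedGradient (fun v => width (f v)) u (c / 2)) {a b : ℝ} (ha : 0 ≤ a)
    (hb : 0 ≤ b) :
    a • x + b • y ∈ (a + b) • weakGradient f u +
      ((a + b) * (c : ℝ)) • Metric.closedBall (0 : EuclideanSpace ℝ (Fin n)) 1 := by
  obtain ⟨x₁, hx₁, x₂, hx₂, rfl⟩ := hx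
  obtain ⟨y₁, hy₁, y₂, hy₂, rfl⟩ := hy
  refine ⟨a • x₁ + b • y₁, ?_, a • x₂ + b • y₂, ?_, ?_⟩
  -- Convexity gives `(a + b) • H = a • H + b • H` for nonnegative weights.
  · rw [weakGradient, (convex_convexHull ℝ _).add_smul ha hb]
    exact Set.add_mem_add
      (Set.smul_mem_smul_set (subset_convexHull ℝ _ (Set.mem_union_left _ hx₁)))
      (Set.smul_mem_smul_set (subset_convexHull ℝ _ (Set.mem_union_right _ hy₁)))
  · have hc : (0 : ℝ) ≤ c := c.2
    have hab : 0 ≤ (a + b) * (c : ℝ) := by positivity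
    rw [smul_closedBall _ _ zero_le_one, smul_zero, mem_closedBall_zero_iff, mul_one,
      Real.norm_of_nonneg hab]
    rw [mem_closedBall_zero_iff, NNReal.coe_div, NNReal.coe_ofNat] at hx₂ hy₂
    refine (norm_add_le _ _).trans ?_
    rw [norm_smul, norm_smul, Real.norm_of_nonneg ha, Real.norm_of_nonneg hb]
    -- The norm is in fact at most `(a + b) * c / 2`, half the radius needed.
    have h₁ := mul_le_mul_of_nonneg_left hx₂ ha
    have h₂ := mul_le_mul_of_nonneg_left hy₂ hb
    linarith
  · simp only [smul_add]
    abel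

end MIOP

theorem corollary4p1 {n m p : ℕ}
    (F : Fin m → EuclideanSpace ℝ (Fin n) → NonemptyInterval ℝ)
    (g : Fin p → EuclideanSpace ℝ (Fin n) → ℝ)
    (hF : ∀ k, MIOP.LocallyLipschitzIVF (F k))
    (hg : ∀ j, LocallyLipschitz (g j))
    (ε : Fin m → ℝ≥0) (hε : ε ≠ 0)
    (ubar : EuclideanSpace ℝ (Fin n))
    (hu : ubar ∈ MIOP.quasiMinimalSet F (MIOP.feasibleSet g) ε)
    (hBCQ : MIOP.BCQ g ubar) :
    ∃ (lam : Fin m → ℝ) (μ : Fin p → ℝ),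
      (∀ k, 0 ≤ lam k) ∧ (∀ j, 0 ≤ μ j) ∧ ∑ k, lam k = 1 ∧
      (0 : EuclideanSpace ℝ (Fin n)) ∈
        (∑ k, lam k • MIOP.weakGradient (F k) ubar)
          + (∑ j ∈ MIOP.activeSet g ubar, μ j • MIOP.clarkeGradient (g j) ubar)
          + (∑ k, (lam k * (ε k : ℝ)) •
              Metric.closedBall (0 : EuclideanSpace ℝ (Fin n)) 1) ∧
      ∀ j, μ j * g j ubar = 0 := by
  obtain ⟨a, b, μ, x, y, v, ha, hb, hμ, hsum, hact, hx, hy, hv, h₀⟩ :=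
    MIOP.exists_fritzJohn hF hg hu
  have hpos : 0 < ∑ k, (a k + b k) := by
    -- If the objective weights sum to `0`, each is `0`; then `μ` sums to `1` and its combination of
    -- subgradients vanishes, violating BCQ.
    refine (Finset.sum_nonneg fun k _ => add_nonneg (ha k) (hb k)).lt_of_ne' fun h => hBCQ ?_
    have hz := (Finset.sum_eq_zero_iff_of_nonneg
      fun k _ => add_nonneg (ha k) (hb k)).1 h
    have ha₀ : ∀ k, a k = 0 := fun k => by
      linarith [hz k (Finset.mem_univ k), ha k, hb k]
    have hb₀ : ∀ k, b k = 0 := fun k => by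
      linarith [hz k (Finset.mem_univ k), ha k, hb k]
    simp only [ha₀, hb₀, zero_smul, Finset.sum_const_zero, zero_add] at hsum h₀
    refine ⟨μ, hμ, ?_, hact, ?_⟩
    · rintro rfl
      simp at hsum
    · rw [← h₀]
      exact Set.finsetSum_mem_finsetSum _ _ _ fun j _ => Set.smul_mem_smul_set (hv j)
  set s := ∑ k, (a k + b k)
  have hs : 0 ≤ s⁻¹ := inv_nonneg.2 hpos.le
  have hmem : ∀ k, (s⁻¹ * a k) • x k + (s⁻¹ * b k) • y k ∈
      (s⁻¹ * (a k + b k)) • MIOP.weakGradient (F k) ubar +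
        (s⁻¹ * (a k + b k) * (ε k : ℝ)) •
          Metric.closedBall (0 : EuclideanSpace ℝ (Fin n)) 1 := fun k => by
    rw [mul_add s⁻¹]
    exact MIOP.smul_add_smul_mem_weakGradient_add_ball (hx k) (hy k)
      (mul_nonneg hs (ha k)) (mul_nonneg hs (hb k))
  refine ⟨fun k => s⁻¹ * (a k + b k), fun j => s⁻¹ * μ j,
    fun k => mul_nonneg hs (add_nonneg (ha k) (hb k)), fun j => mul_nonneg hs (hμ j), ?_, ?_, ?_⟩
  · rw [← Finset.mul_sum, inv_mul_cancel₀ hpos.ne']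
  -- Gradient and ball are regrouped for each `k`, since `hmem` yields them jointly.
  · rw [add_right_comm, ← Finset.sum_add_distrib]
    refine ⟨_, Set.finsetSum_mem_finsetSum _ _ _ fun k _ => hmem k, _,
      Set.finsetSum_mem_finsetSum _ _ _ fun j _ => Set.smul_mem_smul_set (hv j), ?_⟩
    have e : ∑ j ∈ MIOP.activeSet g ubar, (s⁻¹ * μ j) • v j = ∑ j, (s⁻¹ * μ j) • v j :=
      Finset.sum_subset (Finset.subset_univ _) fun j _ hj => by
        rw [hact j hj, mul_zero, zero_smul]
    simp only [e]
    simp only [mul_smul, ← smul_add, ← Finset.smul_sum, Finset.sum_add_distrib, h₀, smul_zero]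
  · intro j
    by_cases hj : j ∈ MIOP.activeSet g ubar
    · rw [(Finset.mem_filter.1 hj).2, mul_zero]
    · simp only [hact j hj, mul_zero, zero_mul]
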